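/- Let $n\ge 3$, let $\mu\in\mathbb{C}$ with $0<|\mu|<1$, let $W=\mathbb{C}^n\setminus\{0\}$, and let $X=W/\langle f\rangle$, $f(z)=\mu z$, be the associated classical Hopf manifold, with quotient map $\pi:W\to X$. A line bundle on $X$ is a bundle $L_b=(W\times\mathbb{C})/\big((z,v)\sim(\mu z,bv)\big)$, $b\in\mathbb{C}^*$. Let $\mathcal{F}$ be a (possibly singular) codimension-one holomorphic foliation on $X$, that is, a holomorphic section of $\Omega^1_X\otimes L_b$ for some $b$, given by a holomorphic $1$-form $\omega$ on $W$ with $f^*\omega=b\,\omega$, such that $\omega\wedge d\omega=0$ and the singular set $\mathrm{Sing}(\mathcal{F})=\pi(\{\omega=0\})$ has codimension at least two. Let $R=\sum_{i} z_i\,\partial/\partial z_i$ be the radial vector field and $\alpha:X\to\mathbb{P}^{n-1}$ the map induced by $z\mapsto[z]$. Then one of the following holds: (a) the set $\pi(\{i_R\omega=0\})$ is a (nonempty) analytic hypersurface of $X$ which is invariant by $\mathcal{F}$, i.e. outside $\mathrm{Sing}(\mathcal{F})$ it is a union of leaves of $\mathcal{F}$; (b) there is a nonsingular one-dimensional holomorphic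 foliation $\mathcal{G}$ on $X$ which is tangent to $\mathcal{F}$ (a subfoliation of $\mathcal{F}$) and whose leaves are the fibers of $\alpha$, each of which is an elliptic curve: it is the image of an injective holomorphic immersion $\mathbb{C}/\Lambda\to X$, with $\Lambda$ a lattice in $\mathbb{C}$, tangent to $\mathcal{G}$. -/

import Mathlib

open scoped Manifold Topology

namespace Hopf

/-! ### Classical Hopf manifolds -/

/-- The model space `ℂⁿ`. -/
abbrev Cn (n : ℕ) : Type := Fin n → ℂ

/-- The open set `W = ℂⁿ ∖ {0}`. -/
def W (n : ℕ) : TopologicalSpace.Opens (Cn n) := ⟨{0}ᶜ, isOpen_compl_singleton⟩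

theorem W_ne_zero {n : ℕ} (w : W n) : (w : Cn n) ≠ 0 := w.2

/-- Nonzero scalars act on `W` by homotheties. -/
instance homothety (n : ℕ) : MulAction ℂˣ (W n) where
  smul c w := ⟨(c : ℂ) • (w : Cn n), smul_ne_zero c.ne_zero (W_ne_zero w)⟩
  one_smul w := Subtype.ext (one_smul ℂ (w : Cn n))
  mul_smul c d w := Subtype.ext (mul_smul (c : ℂ) (d : ℂ) (w : Cn n))

theorem coe_smul {n : ℕ} (c : ℂˣ) (w : W n) :
    ((c • w : W n) : Cn n) = (c : ℂ) • (w : Cn n) := rfl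

theorem coe_zpowers_smul {n : ℕ} {μ : ℂˣ} (c : Subgroup.zpowers μ) (w : W n) :
    ((c • w : W n) : Cn n) = ((c : ℂˣ) : ℂ) • (w : Cn n) := rfl

instance continuousConstSMul (n : ℕ) (μ : ℂˣ) :
    ContinuousConstSMul (Subgroup.zpowers μ) (W n) where
  continuous_const_smul c := by
    refine Continuous.subtype_mk (f := fun w : W n => ((c : ℂˣ) : ℂ) • (w : Cn n)) ?_ _
    fun_prop

instance isCancelSMul (n : ℕ) (μ : ℂˣ) : IsCancelSMul (Subgroup.zpowers μ) (W n) where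
  right_cancel' c d w h := by
    have h1 : ((c : ℂˣ) : ℂ) • (w : Cn n) = ((d : ℂˣ) : ℂ) • (w : Cn n) :=
      congrArg Subtype.val h
    exact Subtype.ext (Units.ext (smul_left_injective ℂ (W_ne_zero w) h1))

/-- Only finitely many integer powers of `r ∈ (0, 1)` lie in a compact subset of `(0, ∞)`. -/
theorem finite_exponents {r : ℝ} (hr0 : 0 < r) (hr1 : r < 1) {m M : ℝ} (hm : 0 < m) :
    {k : ℤ | m ≤ r ^ k ∧ r ^ k ≤ M}.Finite := by
  obtain ⟨p, hp⟩ := exists_pow_lt_of_lt_one hm hr1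
  obtain ⟨q, hq⟩ := pow_unbounded_of_one_lt M (one_lt_inv₀ hr0 |>.2 hr1)
  refine (Set.finite_Icc (-(q : ℤ)) (p : ℤ)).subset ?_
  rintro k ⟨h1, h2⟩
  have anti := zpow_right_strictAnti₀ hr0 hr1
  constructor
  · by_contra! hk
    have := anti hk
    simp only [zpow_neg, zpow_natCast] at this
    rw [inv_pow] at hq
    linarith
  · by_contra! hk
    have := anti hk
    simp only [zpow_natCast] at this
    linarith

instance properlyDiscontinuous (n : ℕ) (μ : ℂˣ) [hμ : Fact (‖(μ : ℂ)‖ < 1)] :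
    ProperlyDiscontinuousSMul (Subgroup.zpowers μ) (W n) where
  finite_disjoint_inter_image {K L} hK hL := by
    rcases K.eq_empty_or_nonempty with rfl | hKne
    · simp
    rcases L.eq_empty_or_nonempty with rfl | hLne
    · simp
    have hc : Continuous fun w : W n => ‖(w : Cn n)‖ := by fun_prop
    obtain ⟨k1, hk1, hk1'⟩ := hK.exists_isMinOn hKne hc.continuousOn
    obtain ⟨k2, hk2, hk2'⟩ := hK.exists_isMaxOn hKne hc.continuousOn
    obtain ⟨l1, hl1, hl1'⟩ := hL.exists_isMinOn hLne hc.continuousOn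
    obtain ⟨l2, hl2, hl2'⟩ := hL.exists_isMaxOn hLne hc.continuousOn
    have pos : ∀ w : W n, 0 < ‖(w : Cn n)‖ := fun w => norm_pos_iff.2 (W_ne_zero w)
    have hr0 : 0 < ‖(μ : ℂ)‖ := norm_pos_iff.2 μ.ne_zero
    have fin := finite_exponents hr0 hμ.out (m := ‖(l1 : Cn n)‖ / ‖(k2 : Cn n)‖)
      (M := ‖(l2 : Cn n)‖ / ‖(k1 : Cn n)‖) (div_pos (pos _) (pos _))
    refine (fin.image fun k : ℤ =>
      (⟨μ ^ k, k, rfl⟩ : Subgroup.zpowers μ)).subset ?_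
    rintro ⟨c, k, rfl⟩ hne
    obtain ⟨y, ⟨x, hx, rfl⟩, hy⟩ := hne
    refine ⟨k, ?_, rfl⟩
    have hn : ‖(((⟨μ ^ k, k, rfl⟩ : Subgroup.zpowers μ) • x : W n) : Cn n)‖ =
        ‖(μ : ℂ)‖ ^ k * ‖(x : Cn n)‖ := by
      rw [coe_zpowers_smul, norm_smul, Units.val_zpow_eq_zpow_val, norm_zpow]
    have e1 : ‖(l1 : Cn n)‖ ≤ ‖(μ : ℂ)‖ ^ k * ‖(x : Cn n)‖ := hn ▸ hl1' hy
    have e2 : ‖(μ : ℂ)‖ ^ k * ‖(x : Cn n)‖ ≤ ‖(l2 : Cn n)‖ := hn ▸ hl2' hy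
    have e3 : ‖(k1 : Cn n)‖ ≤ ‖(x : Cn n)‖ := hk1' hx
    have e4 : ‖(x : Cn n)‖ ≤ ‖(k2 : Cn n)‖ := hk2' hx
    have hz : 0 < ‖(μ : ℂ)‖ ^ k := zpow_pos hr0 k
    constructor
    · rw [div_le_iff₀ (pos _)]
      exact e1.trans (mul_le_mul_of_nonneg_left e4 hz.le)
    · rw [le_div_iff₀ (pos _)]
      exact (mul_le_mul_of_nonneg_left e3 hz.le).trans e2

instance locallyCompactSpace (n : ℕ) : LocallyCompactSpace (W n) :=
  (W n).isOpen.locallyCompactSpace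

/-- The classical Hopf manifold `X = (ℂⁿ ∖ {0}) / ⟨f⟩`, where `f(z) = μ z`. -/
def HopfManifold (n : ℕ) (μ : ℂˣ) : Type :=
  MulAction.orbitRel.Quotient (Subgroup.zpowers μ) (W n)

/-- The universal covering `π : ℂⁿ ∖ {0} → X`. -/
def proj (n : ℕ) (μ : ℂˣ) : W n → HopfManifold n μ :=
  Quotient.mk (MulAction.orbitRel (Subgroup.zpowers μ) (W n))

instance topologicalSpace (n : ℕ) (μ : ℂˣ) : TopologicalSpace (HopfManifold n μ) :=
  inferInstanceAs (TopologicalSpace (MulAction.orbitRel.Quotient (Subgroup.zpowers μ) (W n)))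

/-- The charts of `X` are local inverses of `π`. -/
noncomputable instance chartedSpace (n : ℕ) (μ : ℂˣ) [Fact (‖(μ : ℂ)‖ < 1)] :
    ChartedSpace (Cn n) (HopfManifold n μ) :=
  inferInstanceAs
    (ChartedSpace (Cn n) (MulAction.orbitRel.Quotient (Subgroup.zpowers μ) (W n)))

theorem proj_eq_iff {n : ℕ} {μ : ℂˣ} {w w' : W n} :
    proj n μ w = proj n μ w' ↔ ∃ k : ℤ, (w : Cn n) = ((μ ^ k : ℂˣ) : ℂ) • (w' : Cn n) := by
  refine Quotient.eq''.trans ⟨?_, ?_⟩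
  · rintro ⟨⟨c, k, rfl⟩, h⟩
    exact ⟨k, (congrArg Subtype.val h).symm⟩
  · rintro ⟨k, h⟩
    exact ⟨⟨μ ^ k, k, rfl⟩, Subtype.ext h.symm⟩

theorem isLocalHomeomorph_proj (n : ℕ) (μ : ℂˣ) [Fact (‖(μ : ℂ)‖ < 1)] :
    IsLocalHomeomorph (proj n μ) :=
  (isQuotientCoveringMap_quotientMk_of_properlyDiscontinuousSMul
    (G := Subgroup.zpowers μ) (E := W n)).isCoveringMap.isLocalHomeomorph

theorem chart_W_apply {n : ℕ} (a w : W n) : chartAt (Cn n) a w = (w : Cn n) := rfl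

theorem chart_W_symm {n : ℕ} (a : W n) {z : Cn n} (hz : z ∈ (chartAt (Cn n) a).target) :
    (((chartAt (Cn n) a).symm z : W n) : Cn n) = z :=
  (chart_W_apply a _).symm.trans ((chartAt (Cn n) a).right_inv hz)

theorem contDiffOn_transition {n : ℕ} {μ : ℂˣ} [Fact (‖(μ : ℂ)‖ < 1)] (a b : W n)
    (la lb : OpenPartialHomeomorph (HopfManifold n μ) (W n))
    (ha : ⇑la.symm = proj n μ) (hb : ⇑lb.symm = proj n μ) :
    ContDiffOn ℂ (⊤ : WithTop ℕ∞)
      ((la.trans (chartAt (Cn n) a)).symm.trans (lb.trans (chartAt (Cn n) b)))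
      ((la.trans (chartAt (Cn n) a)).symm.trans (lb.trans (chartAt (Cn n) b))).source := by
  set T := (la.trans (chartAt (Cn n) a)).symm.trans (lb.trans (chartAt (Cn n) b)) with hT
  intro z hz
  have key : ∀ y ∈ T.source, y ∈ (chartAt (Cn n) a).target ∧
      T y = ((lb (proj n μ ((chartAt (Cn n) a).symm y)) : W n) : Cn n) ∧
      proj n μ ((chartAt (Cn n) a).symm y) ∈ lb.source := by
    intro y hy
    simp only [hT, OpenPartialHomeomorph.trans_source, OpenPartialHomeomorph.symm_source,
      Set.mem_inter_iff, Set.mem_preimage,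
      OpenPartialHomeomorph.trans_symm_eq_symm_trans_symm, OpenPartialHomeomorph.coe_trans,
      Function.comp_apply, ha] at hy
    refine ⟨hy.1.1, ?_, hy.2.1⟩
    simp only [hT, OpenPartialHomeomorph.trans_symm_eq_symm_trans_symm,
      OpenPartialHomeomorph.coe_trans, Function.comp_apply, ha]
    rfl
  obtain ⟨hz1, hz2, hz3⟩ := key z hz
  set wz : W n := (chartAt (Cn n) a).symm z with hwz
  have hproj : proj n μ (lb (proj n μ wz)) = proj n μ wz := by
    rw [← hb]; exact lb.left_inv (by rw [hb]; exact hz3)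
  obtain ⟨k, hk⟩ := proj_eq_iff.1 hproj
  have hmem : ∀ᶠ y in 𝓝 z, μ ^ k • (chartAt (Cn n) a).symm y ∈ lb.target := by
    have hc : ContinuousAt (fun y => (⟨μ ^ k, k, rfl⟩ : Subgroup.zpowers μ) •
        (chartAt (Cn n) a).symm y) z :=
      (continuous_const_smul _).continuousAt.comp ((chartAt (Cn n) a).symm.continuousAt hz1)
    refine hc.eventually_mem (lb.open_target.mem_nhds ?_)
    have : (⟨μ ^ k, k, rfl⟩ : Subgroup.zpowers μ) • wz = lb (proj n μ wz) := Subtype.ext hk.symm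
    exact this ▸ lb.map_source hz3
  have heq : T =ᶠ[𝓝 z] fun y => ((μ ^ k : ℂˣ) : ℂ) • y := by
    filter_upwards [hmem, T.open_source.mem_nhds hz] with y hy hys
    obtain ⟨h1, h2, h3⟩ := key y hys
    have : proj n μ ((chartAt (Cn n) a).symm y) =
        proj n μ (μ ^ k • (chartAt (Cn n) a).symm y) :=
      (proj_eq_iff.2 ⟨k, rfl⟩).symm
    rw [h2, this, ← hb, lb.right_inv hy, coe_smul, chart_W_symm a h1]
  have hd : ContDiffAt ℂ (⊤ : WithTop ℕ∞) (fun y : Cn n => ((μ ^ k : ℂˣ) : ℂ) • y) z :=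
    (contDiff_const_smul _).contDiffAt
  exact (hd.congr_of_eventuallyEq heq).contDiffWithinAt

/-- `X` is a complex analytic manifold. -/
instance isManifold (n : ℕ) (μ : ℂˣ) [Fact (‖(μ : ℂ)‖ < 1)] :
    IsManifold 𝓘(ℂ, Cn n) (⊤ : WithTop ℕ∞) (HopfManifold n μ) := by
  apply isManifold_of_contDiffOn
  rintro _ _ ⟨q, rfl⟩ ⟨q', rfl⟩
  simp only [modelWithCornersSelf_coe, modelWithCornersSelf_coe_symm, Function.comp_id,
    Function.id_comp, Set.range_id, Set.inter_univ, Set.preimage_id]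
  exact contDiffOn_transition _ _ _ _
      ((isLocalHomeomorph_proj n μ).localInverseAt_symm _)
      ((isLocalHomeomorph_proj n μ).localInverseAt_symm _)

/-- The natural map `α : X → ℙⁿ⁻¹`, `[z] ↦ [z]`. -/
noncomputable def toProj (n : ℕ) (μ : ℂˣ) : HopfManifold n μ → Projectivization ℂ (Cn n) :=
  Quotient.lift (fun w : W n => Projectivization.mk ℂ (w : Cn n) (W_ne_zero w)) (by
    rintro a b ⟨c, h⟩
    exact (Projectivization.mk_eq_mk_iff ℂ _ _ _ _).2 ⟨c, congrArg Subtype.val h⟩)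

/-! ### Notions on a complex manifold -/

section Manifold

variable {E : Type*} [NormedAddCommGroup E] [NormedSpace ℂ E]
  {M : Type*} [TopologicalSpace M] [ChartedSpace E M]

/-- `H ⊆ M` is a (nonempty, closed) analytic hypersurface: around every point of `M` it is the
zero set of a holomorphic function that vanishes identically on no nonempty open set. -/
def IsAnalyticHypersurface (H : Set M) : Prop :=
  H.Nonempty ∧ ∀ x : M, ∃ U : Set M, IsOpen U ∧ x ∈ U ∧ ∃ h : M → ℂ,
    MDifferentiableOn 𝓘(ℂ, E) 𝓘(ℂ, ℂ) h U ∧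
    (∀ y ∈ U, ¬ ∀ᶠ z in 𝓝 y, h z = 0) ∧
    ∀ y ∈ U, y ∈ H ↔ h y = 0

/-- For an analytic subset `S` (of a manifold of dimension at least two) this says that `S` has
codimension at least two: `S` contains no nonempty zero set of a holomorphic function on an open
set. -/
def CodimAtLeastTwo (S : Set M) : Prop :=
  ∀ U : Set M, IsOpen U → ∀ h : M → ℂ, MDifferentiableOn 𝓘(ℂ, E) 𝓘(ℂ, ℂ) h U →
    (∃ x ∈ U, h x = 0) → ∃ x ∈ U, h x = 0 ∧ x ∉ S

variable (E M) in
/-- A (nonsingular, holomorphic) one-dimensional foliation: a line subbundle of the tangent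
bundle, locally spanned by a holomorphic vector field without zeros. -/
structure LineFoliation [IsManifold 𝓘(ℂ, E) (⊤ : WithTop ℕ∞) M] where
  /-- The tangent line at a point. -/
  line : ∀ x : M, Submodule ℂ (TangentSpace 𝓘(ℂ, E) x)
  locally_spanned : ∀ x : M, ∃ U : Set M, IsOpen U ∧ x ∈ U ∧
    ∃ V : ∀ y : M, TangentSpace 𝓘(ℂ, E) y,
      MDifferentiableOn 𝓘(ℂ, E) 𝓘(ℂ, E).tangent
        (fun y => (⟨y, V y⟩ : TangentBundle 𝓘(ℂ, E) M)) U ∧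
      ∀ y ∈ U, V y ≠ 0 ∧ line y = Submodule.span ℂ {V y}

/-- `L ⊆ M` is a leaf of `G` that is an elliptic curve: there are a lattice `Λ ⊂ ℂ` and a
holomorphic map `φ : ℂ → M` which is everywhere immersive and tangent to `G`, and which induces a
bijection of the elliptic curve `ℂ / Λ` onto `L`. (As `ℂ / Λ` is compact, such an `L` is an entire
leaf.) -/
def LineFoliation.IsEllipticLeaf [IsManifold 𝓘(ℂ, E) (⊤ : WithTop ℕ∞) M]
    (G : LineFoliation E M) (L : Set M) : Prop :=
  ∃ (Λ : Submodule ℤ ℂ) (_ : DiscreteTopology Λ), IsZLattice ℝ Λ ∧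
    ∃ φ : ℂ → M, MDifferentiable 𝓘(ℂ, ℂ) 𝓘(ℂ, E) φ ∧
      (∀ t : ℂ, mfderiv 𝓘(ℂ, ℂ) 𝓘(ℂ, E) φ t (1 : ℂ) ≠ 0) ∧
      (∀ t : ℂ, mfderiv 𝓘(ℂ, ℂ) 𝓘(ℂ, E) φ t (1 : ℂ) ∈ G.line (φ t)) ∧
      (∀ s t : ℂ, φ s = φ t ↔ s - t ∈ Λ) ∧
      Set.range φ = L

end Manifold

/-! ### Codimension-one foliations on `X` -/

/-- A holomorphic section of `Ω¹_X ⊗ L_b`, where `L_b = (W × ℂ) / ((z, v) ∼ (f z, b v))`: it is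
given by a holomorphic `1`-form `ω` on `W` with `f^* ω = b ω`. (Only the values of `form` on `W`
matter.) -/
structure TwistedOneForm (n : ℕ) (μ : ℂˣ) where
  /-- The factor of automorphy of the line bundle. -/
  b : ℂˣ
  /-- The `1`-form on `W`. -/
  form : Cn n → Cn n →L[ℂ] ℂ
  holomorphic : DifferentiableOn ℂ form {0}ᶜ
  equivariant : ∀ z : Cn n, z ≠ 0 → ∀ u : Cn n,
    form ((μ : ℂ) • z) ((μ : ℂ) • u) = (b : ℂ) * form z u

namespace TwistedOneForm

variable {n : ℕ} {μ : ℂˣ}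

/-- The exterior derivative `dω` at `z`, evaluated on the vectors `u`, `v`. -/
noncomputable def extDer (ω : TwistedOneForm n μ) (z u v : Cn n) : ℂ :=
  fderiv ℂ ω.form z u v - fderiv ℂ ω.form z v u

/-- The integrability condition `ω ∧ dω = 0` on `W`. -/
def IsIntegrable (ω : TwistedOneForm n μ) : Prop :=
  ∀ z : Cn n, z ≠ 0 → ∀ u v w : Cn n,
    ω.form z u * ω.extDer z v w - ω.form z v * ω.extDer z u w
      + ω.form z w * ω.extDer z u v = 0

/-- The zero set of `ω` in `X`. -/
def sing (ω : TwistedOneForm n μ) : Set (HopfManifold n μ) :=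
  {x | ∃ w : W n, proj n μ w = x ∧ ω.form w = 0}

/-- The zero set in `X` of the contraction `i_R ω` of `ω` with the radial vector field
`R = ∑ zᵢ ∂/∂zᵢ`. -/
def radialZeroSet (ω : TwistedOneForm n μ) : Set (HopfManifold n μ) :=
  {x | ∃ w : W n, proj n μ w = x ∧ ω.form w (w : Cn n) = 0}

end TwistedOneForm

/-- A (possibly) singular codimension-one holomorphic foliation on the Hopf manifold `X`: an
integrable section of `Ω¹_X ⊗ L_b` whose zero set has codimension at least two. -/
structure CodimOneFoliation (n : ℕ) (μ : ℂˣ) [Fact (‖(μ : ℂ)‖ < 1)] extends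
    TwistedOneForm n μ where
  integrable : toTwistedOneForm.IsIntegrable
  codim_sing : CodimAtLeastTwo (E := Cn n) toTwistedOneForm.sing

namespace CodimOneFoliation

variable {n : ℕ} {μ : ℂˣ} [Fact (‖(μ : ℂ)‖ < 1)]

/-- The tangent vector `p` of `X` is tangent to the foliation: it is annihilated by `ω`. -/
def IsTangent (F : CodimOneFoliation n μ) (p : TangentBundle 𝓘(ℂ, Cn n) (HopfManifold n μ)) :
    Prop :=
  ∃ q : TangentBundle 𝓘(ℂ, Cn n) (W n),
    tangentMap 𝓘(ℂ, Cn n) 𝓘(ℂ, Cn n) (proj n μ) q = p ∧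
    F.form ((q.1 : W n) : Cn n) (q.2 : Cn n) = 0

/-- `H` is invariant by the foliation: away from the singular set it is a union of leaves, i.e. a
holomorphic curve that lies in a leaf and meets `H` stays in `H`. -/
def IsInvariant (F : CodimOneFoliation n μ) (H : Set (HopfManifold n μ)) : Prop :=
  ∀ (D : Set ℂ) (γ : ℂ → HopfManifold n μ), IsOpen D → IsPreconnected D →
    MDifferentiableOn 𝓘(ℂ, ℂ) 𝓘(ℂ, Cn n) γ D →
    (∀ t ∈ D, γ t ∉ F.sing) →
    (∀ t ∈ D, F.IsTangent ⟨γ t, mfderiv 𝓘(ℂ, ℂ) 𝓘(ℂ, Cn n) γ t (1 : ℂ)⟩) →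
    ∀ t₀ ∈ D, γ t₀ ∈ H → ∀ t ∈ D, γ t ∈ H

/-- The one-dimensional foliation `G` is a subfoliation of `F`. -/
def IsSubfoliation (F : CodimOneFoliation n μ) (G : LineFoliation (Cn n) (HopfManifold n μ)) :
    Prop :=
  ∀ x : HopfManifold n μ, ∀ v ∈ G.line x, F.IsTangent ⟨x, v⟩

end CodimOneFoliation

end Hopf

/-! On each punctured line `ℂ* z` the coefficients of `ω` are multiplied by `b / μ` under `t ↦ μ t`.
A holomorphic function on `ℂ*` with this property is a monomial whose exponent `m` depends only on
`b / μ`, so `ω` has coefficients homogeneous of degree `m` (`exists_isHomogeneous`) and `g = i_R ω`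
is homogeneous of degree `m + 1`.

If `g` vanishes identically, the radial field descends to a nowhere zero field on `X` tangent to the
foliation. Its orbits `t ↦ π(exp(t) w)` are the fibers of `α`, and the period group is the lattice
generated by `2πi` and `log μ`.

Otherwise `{g = 0}` is the hypersurface. Homogeneous maps of negative degree on `ℂⁿ ∖ {0}` vanish by
Liouville (`eq_zero_of_homogeneous_neg`). Applied to `ω`, which is not identically zero, this gives
`m ≥ 0`; applied to `1 / g`, it shows that `g` has a zero. For invariance, contracting `ω ∧ dω = 0`
with `R` and using Euler's identity gives `g dω = dg ∧ ω`. Along a tangent curve this becomes a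
linear inequality `|(g ∘ δ)'| ≤ C |g ∘ δ|` near regular points, so a single zero propagates. -/

namespace Hopf

/-! ### Equivariant functions on `ℂ ∖ {0}` and homogeneous maps on `ℂⁿ ∖ {0}` -/

section Homogeneity

variable {E : Type*} [NormedAddCommGroup E] [NormedSpace ℂ E]

/-- A holomorphic function on `ℂ ∖ {0}` that is multiplied by a factor of modulus in `(‖μ‖, 1]`
under `t ↦ μ t` is constant. -/
theorem eq_const_of_equivariant [CompleteSpace E] {μ c : ℂ} (hμ0 : μ ≠ 0) (hμ1 : ‖μ‖ < 1) (hc : ‖μ‖ < ‖c‖)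
    (hc1 : ‖c‖ ≤ 1) {F : ℂ → E} (hF : DifferentiableOn ℂ F {0}ᶜ)
    (heq : ∀ t ≠ 0, F (μ * t) = c • F t) {t : ℂ} (ht : t ≠ 0) : F t = F 1 := by
  have hμp : 0 < ‖μ‖ := norm_pos_iff.2 hμ0
  have hc0 : c ≠ 0 := norm_pos_iff.1 (hμp.trans hc)
  have hpow : ∀ (k : ℕ) (s : ℂ), s ≠ 0 → F (μ ^ k * s) = c ^ k • F s := by
    intro k s hs
    induction k with
    | zero => simp
    | succ k ih =>
      rw [pow_succ', mul_assoc, heq _ (mul_ne_zero (pow_ne_zero _ hμ0) hs), ih, smul_smul,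
        pow_succ']
  -- The annulus `‖μ‖ ≤ ‖s‖ ≤ 1` contains a fundamental domain for `s ↦ μ s`. As `‖c‖ ≤ 1`, a bound
  -- there bounds `F` on the whole punctured disc, so the singularity at `0` is removable.
  have hcomp : IsCompact (Metric.closedBall (0 : ℂ) 1 ∩ {s | ‖μ‖ ≤ ‖s‖}) :=
    (isCompact_closedBall _ _).inter_right (isClosed_le continuous_const continuous_norm)
  have hsub : Metric.closedBall (0 : ℂ) 1 ∩ {s | ‖μ‖ ≤ ‖s‖} ⊆ {0}ᶜ := by
    rintro s ⟨-, hs⟩ rfl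
    simp only [Set.mem_ofPred_eq, norm_zero] at hs
    linarith
  obtain ⟨C, hC⟩ := hcomp.exists_bound_of_continuousOn (hF.continuousOn.mono hsub)
  have hbdd : BddAbove (norm ∘ F '' (Metric.ball (0 : ℂ) 1 \ {0})) := by
    refine ⟨C, ?_⟩
    rintro _ ⟨s, ⟨hs1, hs0⟩, rfl⟩
    have hs0' : s ≠ 0 := hs0
    obtain ⟨k, hk1, hk2⟩ := exists_nat_pow_near_of_lt_one (norm_pos_iff.2 hs0')
      (mem_ball_zero_iff.1 hs1).le hμp hμ1
    have hpk : 0 < ‖μ‖ ^ k := pow_pos hμp k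
    have hs : s = μ ^ k * (s / μ ^ k) := by
      field_simp
    have hn : ‖s / μ ^ k‖ = ‖s‖ / ‖μ‖ ^ k := by simp
    have h1 : ‖F (s / μ ^ k)‖ ≤ C := by
      apply hC
      refine ⟨?_, ?_⟩
      · rw [mem_closedBall_zero_iff, hn, div_le_one hpk]
        exact hk2
      · rw [Set.mem_ofPred_eq, hn, le_div_iff₀ hpk, ← pow_succ']
        exact hk1.le
    have hne : s / μ ^ k ≠ 0 := div_ne_zero hs0' (pow_ne_zero _ hμ0)
    rw [Function.comp_apply, hs, hpow _ _ hne, norm_smul, norm_pow]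
    exact (mul_le_of_le_one_left (norm_nonneg _) (pow_le_one₀ (norm_nonneg _) hc1)).trans h1
  set g : ℂ → E := Function.update F 0 ((𝓝[≠] (0 : ℂ)).limUnder F) with hg
  have hgF : ∀ s ≠ 0, g s = F s := fun s hs => Function.update_of_ne hs _ _
  have hgd : Differentiable ℂ g := by
    have h1 : DifferentiableOn ℂ g (Metric.ball 0 1) :=
      Complex.differentiableOn_update_limUnder_of_bddAbove (Metric.ball_mem_nhds 0 one_pos)
        (hF.mono fun s hs => hs.2) hbdd
    intro s
    rcases eq_or_ne s 0 with rfl | hs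
    · exact h1.differentiableAt (Metric.ball_mem_nhds 0 one_pos)
    · refine (hF.differentiableAt (isOpen_compl_singleton.mem_nhds hs)).congr_of_eventuallyEq ?_
      filter_upwards [isOpen_compl_singleton.mem_nhds hs] with y hy using hgF y hy
  -- Differentiating the equivariance gains a factor `μ / c` of modulus `< 1`. Iterating moves the
  -- argument to `0`, where the derivative is continuous, and forces it to vanish.
  have hder : ∀ s ≠ 0, deriv g s = (μ / c) • deriv g (μ * s) := by
    intro s hs
    have h1 : HasDerivAt (fun s => g (μ * s)) (μ • deriv g (μ * s)) s := by
      have := (hgd (μ * s)).hasDerivAt.scomp s ((hasDerivAt_id s).const_mul μ)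
      simpa [Function.comp_def] using this
    have h2 : HasDerivAt (fun s => c • g s) (c • deriv g s) s :=
      (hgd s).hasDerivAt.const_smul c
    have h3 : (fun s => g (μ * s)) =ᶠ[𝓝 s] fun s => c • g s := by
      filter_upwards [isOpen_compl_singleton.mem_nhds hs] with y hy
      rw [hgF _ (mul_ne_zero hμ0 hy), hgF _ hy, heq _ hy]
    have h4 := (h1.congr_of_eventuallyEq h3.symm).unique h2
    rw [div_eq_inv_mul, mul_smul, h4, smul_smul, inv_mul_cancel₀ hc0, one_smul]
  have hderpow : ∀ (k : ℕ) (s : ℂ), s ≠ 0 → deriv g s = (μ / c) ^ k • deriv g (μ ^ k * s) := by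
    intro k s hs
    induction k with
    | zero => simp
    | succ k ih =>
      rw [ih, hder _ (mul_ne_zero (pow_ne_zero _ hμ0) hs), smul_smul, ← pow_succ, ← mul_assoc,
        ← pow_succ']
  have hcont : Continuous (deriv g) := (hgd.contDiff (n := 1)).continuous_deriv le_rfl
  have hzero : ∀ s ≠ 0, deriv g s = 0 := by
    intro s hs
    have h1 : Filter.Tendsto (fun k : ℕ => (μ / c) ^ k) Filter.atTop (𝓝 0) := by
      apply tendsto_pow_atTop_nhds_zero_of_norm_lt_one
      rw [norm_div]
      exact (div_lt_one (hμp.trans hc)).2 hc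
    have h2 : Filter.Tendsto (fun k : ℕ => μ ^ k * s) Filter.atTop (𝓝 0) := by
      simpa using (tendsto_pow_atTop_nhds_zero_of_norm_lt_one hμ1).mul_const s
    have h3 := h1.smul ((hcont.tendsto 0).comp h2)
    rw [zero_smul] at h3
    refine tendsto_nhds_unique ?_ h3
    refine tendsto_const_nhds.congr fun k => ?_
    exact hderpow k s hs
  have hall : deriv g = fun _ => 0 :=
    hcont.ext_on (dense_compl_singleton (0 : ℂ)) continuous_const fun s hs => hzero s hs
  rw [← hgF t ht, ← hgF 1 one_ne_zero]
  exact is_const_of_deriv_eq_zero hgd (fun s => congrFun hall s) _ _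

/-- Holomorphic functions on `ℂ ∖ {0}` that are equivariant under `t ↦ μ t` are monomials. -/
theorem exists_zpow_of_equivariant [CompleteSpace E] {μ c : ℂ} (hμ0 : μ ≠ 0) (hμ1 : ‖μ‖ < 1) (hc0 : c ≠ 0) :
    ∃ m : ℤ, ∀ F : ℂ → E, DifferentiableOn ℂ F {0}ᶜ → (∀ t ≠ 0, F (μ * t) = c • F t) →
      ∀ t ≠ 0, F t = t ^ m • F 1 := by
  have hμp : 0 < ‖μ‖ := norm_pos_iff.2 hμ0
  -- This `k` satisfies `‖μ‖ ^ (-k) < ‖c‖ ≤ ‖μ‖ ^ (-k - 1)`. Dividing `F` by `t ^ (-k - 1)`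
  -- therefore brings the modulus of the factor into `(‖μ‖, 1]`. The choice depends on `c` and `μ`
  -- alone, not on `F`.
  obtain ⟨k, hk1, hk2⟩ := exists_mem_Ioc_zpow (norm_pos_iff.2 hc0) ((one_lt_inv₀ hμp).2 hμ1)
  refine ⟨-k - 1, fun F hF heq t ht => ?_⟩
  set m : ℤ := -k - 1 with hm
  have hn : ‖c * μ ^ (-m)‖ = ‖c‖ * ‖μ‖ ^ (-m) := by simp
  have hz : 0 < ‖μ‖ ^ (-m) := zpow_pos hμp _
  have hk1' : ‖μ‖ < ‖c * μ ^ (-m)‖ := by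
    rw [hn]
    have := mul_lt_mul_of_pos_right hk1 hz
    rw [inv_zpow', ← zpow_add₀ hμp.ne', hm, show -k + -(-k - 1) = 1 by ring, zpow_one] at this
    exact this
  have hk2' : ‖c * μ ^ (-m)‖ ≤ 1 := by
    rw [hn]
    have := mul_le_mul_of_nonneg_right hk2 hz.le
    rw [inv_zpow', ← zpow_add₀ hμp.ne', hm, show -(k + 1) + -(-k - 1) = 0 by ring,
      zpow_zero] at this
    exact this
  have hd : DifferentiableOn ℂ (fun s : ℂ => s ^ (-m) • F s) {0}ᶜ := by
    refine DifferentiableOn.smul (fun s hs => ?_) hF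
    exact (differentiableAt_zpow.2 (Or.inl hs)).differentiableWithinAt
  have := eq_const_of_equivariant hμ0 hμ1 hk1' hk2' hd (fun s hs => by
    rw [heq s hs, mul_zpow, smul_smul, smul_smul]
    congr 1
    ring) ht
  simp only [one_zpow, one_smul] at this
  rw [← this, smul_smul, ← zpow_add₀ ht, add_neg_cancel, zpow_zero, one_smul]

/-- A holomorphic map on `ℂⁿ ∖ {0}`, `n ≥ 2`, which is homogeneous of negative degree vanishes. -/
theorem eq_zero_of_homogeneous_neg {n : ℕ} (hn : 2 ≤ n) {G : Cn n → E} {m : ℤ} (hm : m < 0)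
    (hG : DifferentiableOn ℂ G {0}ᶜ)
    (hom : ∀ t : ℂ, t ≠ 0 → ∀ z : Cn n, z ≠ 0 → G (t • z) = t ^ m • G z)
    {p : Cn n} (hp : p ≠ 0) : G p = 0 := by
  -- The line `p + t q` avoids the origin, so `G` restricts to an entire function on it. Since `G (p
  -- + t q) = t ^ m G (t⁻¹ p + q)` tends to `0` at infinity, Liouville makes it zero, in particular
  -- at `t = 0`.
  obtain ⟨q, hq⟩ := exists_linearIndependent_pair_of_one_lt_finrank (R := ℂ)
    (by simpa using Nat.lt_of_succ_le hn) hp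
  rw [LinearIndependent.pair_iff] at hq
  have hne : ∀ t : ℂ, p + t • q ≠ 0 := fun t h => by
    simpa using (hq 1 t (by simpa using h)).1
  have hne' : ∀ t : ℂ, t • p + q ≠ 0 := fun t h => by
    simpa using (hq t 1 (by simpa using h)).2
  have hat : ∀ z : Cn n, z ≠ 0 → DifferentiableAt ℂ G z := fun z hz =>
    hG.differentiableAt (isOpen_compl_singleton.mem_nhds hz)
  have hd : Differentiable ℂ fun t : ℂ => G (p + t • q) := fun t =>
    (hat _ (hne t)).comp t (by fun_prop)
  have hinv : Filter.Tendsto (fun t : ℂ => t⁻¹) (Filter.cocompact ℂ) (𝓝 0) :=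
    Filter.tendsto_inv₀_cobounded.mono_left (by rw [Metric.cobounded_eq_cocompact])
  have hlim : Filter.Tendsto (fun t : ℂ => G (p + t • q)) (Filter.cocompact ℂ) (𝓝 0) := by
    have h1 : Filter.Tendsto (fun t : ℂ => t⁻¹ ^ (-m).toNat) (Filter.cocompact ℂ) (𝓝 0) := by
      simpa [zero_pow (show (-m).toNat ≠ 0 by omega)] using hinv.pow (-m).toNat
    have h2 : Filter.Tendsto (fun t : ℂ => G (t⁻¹ • p + q)) (Filter.cocompact ℂ)
        (𝓝 (G ((0 : ℂ) • p + q))) :=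
      ((hat _ (hne' 0)).continuousAt.tendsto).comp
        ((hinv.smul_const p).add_const q)
    have h3 := h1.smul h2
    rw [zero_smul] at h3
    refine h3.congr' ?_
    have h0 : ∀ᶠ t : ℂ in Filter.cocompact ℂ, t ≠ 0 := by
      have := (isCompact_singleton (x := (0 : ℂ))).compl_mem_cocompact
      filter_upwards [this] with t ht using ht
    filter_upwards [h0] with t ht
    have : p + t • q = t • (t⁻¹ • p + q) := by
      rw [smul_add, smul_smul, mul_inv_cancel₀ ht, one_smul]
    rw [this, hom t ht _ (hne' _), inv_pow, ← zpow_natCast, ← zpow_neg]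
    congr 2
    omega
  have := hd.apply_eq_of_tendsto_cocompact 0 hlim
  simpa using this

end Homogeneity

/-! ### Homogeneity of `ω` and the contraction `i_R ω` -/

namespace TwistedOneForm

variable {n : ℕ} {μ : ℂˣ}

theorem differentiableAt (ω : TwistedOneForm n μ) {z : Cn n} (hz : z ≠ 0) :
    DifferentiableAt ℂ ω.form z :=
  ω.holomorphic.differentiableAt (isOpen_compl_singleton.mem_nhds hz)

/-- The contraction `i_R ω` of `ω` with the radial vector field. -/
noncomputable def radial (ω : TwistedOneForm n μ) (z : Cn n) : ℂ := ω.form z z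

theorem hasFDerivAt_radial (ω : TwistedOneForm n μ) {z : Cn n} (hz : z ≠ 0) :
    HasFDerivAt ω.radial (ω.form z + (fderiv ℂ ω.form z).flip z) z := by
  have h := (ω.differentiableAt hz).hasFDerivAt.clm_apply (hasFDerivAt_id z)
  rw [ContinuousLinearMap.comp_id] at h
  exact h

theorem differentiableOn_radial (ω : TwistedOneForm n μ) :
    DifferentiableOn ℂ ω.radial {0}ᶜ := fun _ hz =>
  (ω.hasFDerivAt_radial hz).differentiableAt.differentiableWithinAt

/-- The coefficients of `ω` are homogeneous of degree `m`. -/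
def IsHomogeneous (ω : TwistedOneForm n μ) (m : ℤ) : Prop :=
  ∀ t : ℂ, t ≠ 0 → ∀ z : Cn n, z ≠ 0 → ω.form (t • z) = t ^ m • ω.form z

/-- The pullback also scales the vector by `μ`, so the coefficients are multiplied by `b / μ`, not
`b`. The exponent is the same for all `z` because it is fixed by this factor alone. -/
theorem exists_isHomogeneous (hμ : ‖(μ : ℂ)‖ < 1) (ω : TwistedOneForm n μ) :
    ∃ m : ℤ, ω.IsHomogeneous m := by
  have hc0 : (ω.b : ℂ) / μ ≠ 0 := div_ne_zero ω.b.ne_zero μ.ne_zero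
  obtain ⟨m, hm⟩ := exists_zpow_of_equivariant (E := Cn n →L[ℂ] ℂ) μ.ne_zero hμ hc0
  refine ⟨m, fun t ht z hz => ?_⟩
  have := hm (fun t => ω.form (t • z)) ?_ ?_ t ht
  · simpa using this
  · intro s hs
    have hsz : s • z ≠ 0 := smul_ne_zero hs hz
    exact ((ω.differentiableAt hsz).comp s (by fun_prop)).differentiableWithinAt
  · intro s hs
    ext u
    have := ω.equivariant (s • z) (smul_ne_zero hs hz) u
    rw [map_smul, smul_eq_mul] at this
    simp only [_root_.smul_apply, smul_eq_mul, mul_smul]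
    rw [div_mul_eq_mul_div, ← this]
    field_simp

variable {ω : TwistedOneForm n μ} {m : ℤ}

theorem IsHomogeneous.radial (hω : ω.IsHomogeneous m) {t : ℂ} (ht : t ≠ 0) {z : Cn n}
    (hz : z ≠ 0) : ω.radial (t • z) = t ^ (m + 1) * ω.radial z := by
  simp only [TwistedOneForm.radial]
  rw [hω t ht z hz, zpow_add_one₀ ht, map_smul]
  simp only [_root_.smul_apply, smul_eq_mul]
  ring

theorem IsHomogeneous.radial_eq_zero_iff (hω : ω.IsHomogeneous m) {t : ℂ} (ht : t ≠ 0)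
    {z : Cn n} (hz : z ≠ 0) : ω.radial (t • z) = 0 ↔ ω.radial z = 0 := by
  rw [hω.radial ht hz, mul_eq_zero, or_iff_right (zpow_ne_zero _ ht)]

/-- Euler's identity: differentiate the homogeneity relation in `t` at `t = 1`. -/
theorem IsHomogeneous.fderiv_self (hω : ω.IsHomogeneous m) {z : Cn n} (hz : z ≠ 0) :
    fderiv ℂ ω.form z z = (m : ℂ) • ω.form z := by
  have h1 : HasDerivAt (fun t : ℂ => ω.form (t • z)) (fderiv ℂ ω.form z z) 1 := by
    have h := (ω.differentiableAt (z := (1 : ℂ) • z) (by simpa using hz)).hasFDerivAt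
    have := h.comp_hasDerivAt (1 : ℂ) ((hasDerivAt_id (1 : ℂ)).smul_const z)
    simpa [Function.comp_def] using this
  have h2 : HasDerivAt (fun t : ℂ => t ^ m • ω.form z) ((m : ℂ) • ω.form z) 1 := by
    simpa using (hasDerivAt_zpow m (1 : ℂ) (Or.inl one_ne_zero)).smul_const (ω.form z)
  refine (h1.congr_of_eventuallyEq ?_).unique h2
  filter_upwards [isOpen_compl_singleton.mem_nhds (one_ne_zero (α := ℂ))] with t ht
  exact (hω t ht z hz).symm

/-- `i_R ω · dω = d(i_R ω) ∧ ω` for an integrable homogeneous `1`-form. -/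
theorem IsIntegrable.radial_mul_extDer (hi : ω.IsIntegrable) (hω : ω.IsHomogeneous m) {z : Cn n}
    (hz : z ≠ 0) (v w : Cn n) :
    ω.radial z * ω.extDer z v w =
      fderiv ℂ ω.radial z v * ω.form z w - fderiv ℂ ω.radial z w * ω.form z v := by
  have h := hi z hz z v w
  -- The integrability condition was taken with first vector `R = z`. By Euler's identity the terms
  -- containing `m` cancel in it, as do the products of two values of `ω` on the right.
  rw [(ω.hasFDerivAt_radial hz).fderiv]
  simp only [extDer, hω.fderiv_self hz, _root_.smul_apply, smul_eq_mul,
    _root_.add_apply, ContinuousLinearMap.flip_apply, TwistedOneForm.radial] at h ⊢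
  linear_combination h

theorem IsHomogeneous.form_eq_zero_of_neg (hω : ω.IsHomogeneous m) (hn : 2 ≤ n) (hm : m < 0)
    {z : Cn n} (hz : z ≠ 0) : ω.form z = 0 :=
  eq_zero_of_homogeneous_neg hn hm ω.holomorphic hω hz

/-- Without zeros, the reciprocal of `i_R ω` would be holomorphic and homogeneous of degree `-(m +
1) < 0`, hence zero. -/
theorem IsHomogeneous.exists_radial_eq_zero (hω : ω.IsHomogeneous m) (hn : 2 ≤ n) (hm : 0 ≤ m) :
    ∃ z : Cn n, z ≠ 0 ∧ ω.radial z = 0 := by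
  by_contra! h
  have hne : (fun _ => 1 : Cn n) ≠ 0 := fun h0 => by
    simpa using congrFun h0 ⟨0, by omega⟩
  have := eq_zero_of_homogeneous_neg hn (m := -(m + 1)) (by omega)
    (G := fun z => (ω.radial z)⁻¹) (ω.differentiableOn_radial.inv fun z hz => h z hz)
    (fun t ht z hz => by rw [hω.radial ht hz, mul_inv, zpow_neg, smul_eq_mul]) hne
  exact h _ hne (inv_eq_zero.1 this)

/-- Apply the identity theorem on the complex line through `y` and `p`. If that line contains the
origin, then `p` is a multiple of `y` and homogeneity suffices. -/
theorem IsHomogeneous.radial_eq_zero_of_eventually (hω : ω.IsHomogeneous m) {y : Cn n}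
    (hy : y ≠ 0) (h : ∀ᶠ z in 𝓝 y, ω.radial z = 0) {p : Cn n} (hp : p ≠ 0) : ω.radial p = 0 := by
  by_cases hline : ∀ t : ℂ, y + t • (p - y) ≠ 0
  · have hd : Differentiable ℂ fun t : ℂ => ω.radial (y + t • (p - y)) := fun t =>
      ((ω.hasFDerivAt_radial (hline t)).differentiableAt).comp (f := fun t : ℂ => y + t • (p - y)) t
        (by fun_prop)
    have hev : (fun t : ℂ => ω.radial (y + t • (p - y))) =ᶠ[𝓝 0] 0 := by
      have hc : ContinuousAt (fun t : ℂ => y + t • (p - y)) 0 := by fun_prop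
      exact hc.eventually (by simpa using h)
    have := (hd.differentiableOn.analyticOnNhd isOpen_univ).eqOn_zero_of_preconnected_of_eventuallyEq_zero
      isPreconnected_univ (Set.mem_univ 0) hev (Set.mem_univ 1)
    simpa using this
  · push Not at hline
    obtain ⟨t, ht⟩ := hline
    have ht0 : t ≠ 0 := by rintro rfl; exact hy (by simpa using ht)
    have h1 : t • p = (t - 1) • y := by
      rw [sub_smul, one_smul, eq_sub_iff_add_eq, ← sub_eq_zero, ← ht, smul_sub]
      abel
    have ht1 : t - 1 ≠ 0 := by
      intro h0
      rw [h0, zero_smul] at h1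
      exact smul_ne_zero ht0 hp h1
    rw [← hω.radial_eq_zero_iff ht0 hp, h1, hω.radial_eq_zero_iff ht1 hy]
    exact h.self_of_nhds

end TwistedOneForm

/-! ### Charts of `X` as local inverses of `π` -/

section Charts

variable {n : ℕ} {μ : ℂˣ}

theorem proj_surjective (n : ℕ) (μ : ℂˣ) : Function.Surjective (proj n μ) :=
  Quotient.mk_surjective

variable [Fact (‖(μ : ℂ)‖ < 1)]

theorem exists_localInverse (x : HopfManifold n μ) :
    ∃ (l : OpenPartialHomeomorph (HopfManifold n μ) (W n)) (a : W n),
      ⇑l.symm = proj n μ ∧ chartAt (Cn n) x = l.trans (chartAt (Cn n) a) :=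
  ⟨_, _, (isLocalHomeomorph_proj n μ).localInverseAt_symm _, rfl⟩

/-- This holds even for `y` outside the chart's source, since the chart factors through `W`; hence
`lift` is total. -/
theorem chartAt_ne_zero (x y : HopfManifold n μ) : chartAt (Cn n) x y ≠ 0 := by
  obtain ⟨l, a, hl, he⟩ := exists_localInverse x
  rw [he]
  exact W_ne_zero (l y)

/-- The local lift of `X` to `W` given by the chart at `x`. -/
noncomputable def lift (x y : HopfManifold n μ) : W n := ⟨chartAt (Cn n) x y, chartAt_ne_zero x y⟩

theorem coe_lift (x y : HopfManifold n μ) : (lift x y : Cn n) = chartAt (Cn n) x y := rfl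

theorem proj_lift {x y : HopfManifold n μ} (hy : y ∈ (chartAt (Cn n) x).source) :
    proj n μ (lift x y) = y := by
  obtain ⟨l, a, hl, he⟩ := exists_localInverse x
  have h1 : lift x y = l y := Subtype.ext (by rw [coe_lift, he]; rfl)
  rw [he] at hy
  rw [h1, ← hl]
  exact l.left_inv hy.1

/-- In the charts of `X` the covering `π` is locally a homothety by a power of `μ`. -/
theorem exists_chartAt_proj_eventuallyEq {x : HopfManifold n μ} {w : W n}
    (hw : proj n μ w ∈ (chartAt (Cn n) x).source) :
    ∃ k : ℤ, ∀ᶠ w' in 𝓝 w,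
      chartAt (Cn n) x (proj n μ w') = ((μ ^ k : ℂˣ) : ℂ) • (w' : Cn n) := by
  obtain ⟨l, a, hl, he⟩ := exists_localInverse x
  have hval : ∀ y, chartAt (Cn n) x y = (l y : Cn n) := fun y => by rw [he]; rfl
  have hs : proj n μ w ∈ l.source := by rw [he] at hw; exact hw.1
  have hproj : proj n μ (l (proj n μ w)) = proj n μ w := by
    rw [← hl]; exact l.left_inv (by rw [hl]; exact hs)
  obtain ⟨k, hk⟩ := proj_eq_iff.1 hproj
  refine ⟨k, ?_⟩
  have hmem : ∀ᶠ w' in 𝓝 w, μ ^ k • w' ∈ l.target := by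
    have hc : ContinuousAt (fun w' : W n => (⟨μ ^ k, k, rfl⟩ : Subgroup.zpowers μ) • w') w :=
      (continuous_const_smul _).continuousAt
    refine hc.eventually_mem (l.open_target.mem_nhds ?_)
    have : (⟨μ ^ k, k, rfl⟩ : Subgroup.zpowers μ) • w = l (proj n μ w) := Subtype.ext hk.symm
    exact this ▸ l.map_source hs
  filter_upwards [hmem] with w' hw'
  have : proj n μ w' = proj n μ (μ ^ k • w') := (proj_eq_iff.2 ⟨k, rfl⟩).symm
  rw [hval, this, ← hl, l.right_inv hw', coe_smul]

theorem eventually_coe_chartAt_symm (w : W n) :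
    ∀ᶠ z in 𝓝 (w : Cn n), (((chartAt (Cn n) w).symm z : W n) : Cn n) = z := by
  filter_upwards [(chartAt (Cn n) w).open_target.mem_nhds (mem_chart_target (Cn n) w)] with z hz
    using chart_W_symm w hz

theorem hasMFDerivAt_coe (w : W n) :
    HasMFDerivAt 𝓘(ℂ, Cn n) 𝓘(ℂ, Cn n) (fun w : W n => (w : Cn n)) w
      (ContinuousLinearMap.id ℂ (Cn n)) := by
  refine ⟨continuous_subtype_val.continuousAt, ?_⟩
  simp only [mfld_simps]
  exact ((hasFDerivAt_id (𝕜 := ℂ) (w : Cn n)).congr_of_eventuallyEq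
    (eventually_coe_chartAt_symm w)).hasFDerivWithinAt

theorem exists_hasMFDerivAt_proj (w : W n) :
    ∃ k : ℤ, chartAt (Cn n) (proj n μ w) (proj n μ w) = ((μ ^ k : ℂˣ) : ℂ) • (w : Cn n) ∧
      HasMFDerivAt 𝓘(ℂ, Cn n) 𝓘(ℂ, Cn n) (proj n μ) w
        (((μ ^ k : ℂˣ) : ℂ) • ContinuousLinearMap.id ℂ (Cn n)) := by
  obtain ⟨k, hk⟩ := exists_chartAt_proj_eventuallyEq (mem_chart_source (Cn n) (proj n μ w))
  refine ⟨k, hk.self_of_nhds, (isLocalHomeomorph_proj n μ).continuous.continuousAt, ?_⟩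
  simp only [mfld_simps]
  refine (((hasFDerivAt_id (𝕜 := ℂ) (w : Cn n)).const_smul
    ((μ ^ k : ℂˣ) : ℂ)).congr_of_eventuallyEq ?_).hasFDerivWithinAt
  have hc : Filter.Tendsto (chartAt (Cn n) w).symm (𝓝 (w : Cn n)) (𝓝 w) := by
    have := ((chartAt (Cn n) w).continuousAt_symm (mem_chart_target (Cn n) w)).tendsto
    rwa [(chartAt (Cn n) w).left_inv (mem_chart_source (Cn n) w)] at this
  filter_upwards [hc.eventually hk, eventually_coe_chartAt_symm w] with z hz hz'
  simp only [Function.comp_apply]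
  rw [hz, hz']
  rfl

theorem mdifferentiableAt_proj (w : W n) :
    MDifferentiableAt 𝓘(ℂ, Cn n) 𝓘(ℂ, Cn n) (proj n μ) w := by
  obtain ⟨k, -, hk⟩ := exists_hasMFDerivAt_proj (μ := μ) w
  exact hk.mdifferentiableAt

theorem mdifferentiableAt_chartAt {x y : HopfManifold n μ}
    (hy : y ∈ (chartAt (Cn n) x).source) :
    MDifferentiableAt 𝓘(ℂ, Cn n) 𝓘(ℂ, Cn n) (chartAt (Cn n) x) y :=
  mdifferentiableAt_atlas (chart_mem_atlas _ x) hy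

/-- The differential of `π` in the chart at `x`. -/
theorem exists_mfderiv_chartAt_proj {x : HopfManifold n μ} {w : W n}
    (hw : proj n μ w ∈ (chartAt (Cn n) x).source) :
    ∃ k : ℤ, chartAt (Cn n) x (proj n μ w) = ((μ ^ k : ℂˣ) : ℂ) • (w : Cn n) ∧
      ∀ u : Cn n, mfderiv 𝓘(ℂ, Cn n) 𝓘(ℂ, Cn n) (chartAt (Cn n) x) (proj n μ w)
        (mfderiv 𝓘(ℂ, Cn n) 𝓘(ℂ, Cn n) (proj n μ) w u) = ((μ ^ k : ℂˣ) : ℂ) • u := by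
  obtain ⟨k, hk⟩ := exists_chartAt_proj_eventuallyEq hw
  refine ⟨k, hk.self_of_nhds, fun u => ?_⟩
  have h1 : HasMFDerivAt 𝓘(ℂ, Cn n) 𝓘(ℂ, Cn n) (chartAt (Cn n) x ∘ proj n μ) w
      ((mfderiv 𝓘(ℂ, Cn n) 𝓘(ℂ, Cn n) (chartAt (Cn n) x) (proj n μ w)).comp
        (mfderiv 𝓘(ℂ, Cn n) 𝓘(ℂ, Cn n) (proj n μ) w)) :=
    (mdifferentiableAt_chartAt hw).hasMFDerivAt.comp w (mdifferentiableAt_proj w).hasMFDerivAt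
  have h2 : HasMFDerivAt 𝓘(ℂ, Cn n) 𝓘(ℂ, Cn n)
      (fun w' : W n => ((μ ^ k : ℂˣ) : ℂ) • (w' : Cn n)) w
      (((μ ^ k : ℂˣ) : ℂ) • ContinuousLinearMap.id ℂ (Cn n)) :=
    (hasMFDerivAt_coe w).const_smul _
  have h3 := hasMFDerivAt_unique h1 (h2.congr_of_eventuallyEq hk)
  exact congrArg (fun A : Cn n →L[ℂ] Cn n => A u) h3

theorem chartAt_mfderiv_proj_self (w : W n) :
    mfderiv 𝓘(ℂ, Cn n) 𝓘(ℂ, Cn n) (proj n μ) w (w : Cn n) =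
      chartAt (Cn n) (proj n μ w) (proj n μ w) := by
  obtain ⟨k, hk, hd⟩ := exists_hasMFDerivAt_proj (μ := μ) w
  rw [hd.mfderiv, hk]
  rfl

end Charts

theorem TwistedOneForm.form_zpow_smul {n : ℕ} {μ : ℂˣ} (ω : TwistedOneForm n μ) (k : ℤ)
    {z : Cn n} (hz : z ≠ 0) (u : Cn n) :
    ω.form (((μ ^ k : ℂˣ) : ℂ) • z) (((μ ^ k : ℂˣ) : ℂ) • u) =
      ((ω.b ^ k : ℂˣ) : ℂ) * ω.form z u := by
  have hne : ∀ k : ℤ, ((μ ^ k : ℂˣ) : ℂ) • z ≠ 0 := fun k => smul_ne_zero (Units.ne_zero _) hz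
  induction k with
  | zero => simp
  | succ k ih =>
    have := ω.equivariant _ (hne k) (((μ ^ (k : ℤ) : ℂˣ) : ℂ) • u)
    rw [ih] at this
    rw [zpow_add_one, zpow_add_one, mul_comm, Units.val_mul, mul_smul, mul_smul, this,
      Units.val_mul]
    ring
  | pred k ih =>
    have := ω.equivariant _ (hne (-k - 1)) (((μ ^ (-k - 1 : ℤ) : ℂˣ) : ℂ) • u)
    rw [smul_smul, smul_smul, ← Units.val_mul, ← zpow_one_add, add_sub_cancel, ih] at this
    have hb : ω.b ^ (-k : ℤ) = ω.b * ω.b ^ (-k - 1 : ℤ) := by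
      rw [← zpow_one_add, add_sub_cancel]
    rw [hb, Units.val_mul, mul_assoc] at this
    exact (mul_left_cancel₀ ω.b.ne_zero this).symm

section

variable {n : ℕ} {μ : ℂˣ} [Fact (‖(μ : ℂ)‖ < 1)]

/-- Tangency is witnessed by some lift to `W`. The chart gives another lift, differing by a power `μ
^ k`, which only multiplies the value of `ω` by `b ^ k`. -/
theorem CodimOneFoliation.IsTangent.form_chartAt {F : CodimOneFoliation n μ}
    {x y : HopfManifold n μ} {v : TangentSpace 𝓘(ℂ, Cn n) y} (h : F.IsTangent ⟨y, v⟩)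
    (hy : y ∈ (chartAt (Cn n) x).source) :
    F.form (chartAt (Cn n) x y)
      (mfderiv 𝓘(ℂ, Cn n) 𝓘(ℂ, Cn n) (chartAt (Cn n) x) y v) = 0 := by
  obtain ⟨⟨w, u⟩, hq, h0⟩ := h
  change (⟨proj n μ w, mfderiv 𝓘(ℂ, Cn n) 𝓘(ℂ, Cn n) (proj n μ) w u⟩ :
    TangentBundle 𝓘(ℂ, Cn n) (HopfManifold n μ)) = ⟨y, v⟩ at hq
  cases hq
  obtain ⟨k, hk, hd⟩ := exists_mfderiv_chartAt_proj hy
  have h1 := F.form_zpow_smul k (W_ne_zero w) u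
  rw [h0, mul_zero, ← hd u, ← hk] at h1
  exact h1

namespace TwistedOneForm

variable {ω : TwistedOneForm n μ} {m : ℤ}

theorem IsHomogeneous.mem_radialZeroSet_iff (hω : ω.IsHomogeneous m) {x y : HopfManifold n μ}
    (hy : y ∈ (chartAt (Cn n) x).source) :
    y ∈ ω.radialZeroSet ↔ ω.radial (chartAt (Cn n) x y) = 0 := by
  constructor
  · rintro ⟨w, hw, h⟩
    rw [← proj_lift hy] at hw
    obtain ⟨k, hk⟩ := proj_eq_iff.1 hw
    change ω.radial w = 0 at h
    rwa [hk, hω.radial_eq_zero_iff (Units.ne_zero _) (W_ne_zero _)] at h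
  · intro h
    exact ⟨lift x y, proj_lift hy, h⟩

end TwistedOneForm

end

/-! ### Differential inequalities and invariance of `{i_R ω = 0}` -/

/-- The derivative of a holomorphic map is locally bounded, by the Cauchy estimates. -/
theorem exists_norm_fderiv_le {V E : Type*} [NormedAddCommGroup V] [NormedSpace ℂ V]
    [NormedAddCommGroup E] [NormedSpace ℂ E] {G : V → E} {z₀ : V}
    (h : ∀ᶠ z in 𝓝 z₀, DifferentiableAt ℂ G z) :
    ∃ K, ∀ᶠ z in 𝓝 z₀, ‖fderiv ℂ G z‖ ≤ K := by
  have hb : ∀ᶠ z in 𝓝 z₀, ‖G z‖ < ‖G z₀‖ + 1 :=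
    h.self_of_nhds.continuousAt.norm.eventually_lt_const (lt_add_one _)
  obtain ⟨r, hr, hball⟩ := Metric.eventually_nhds_iff_ball.1 (h.and hb)
  have hr2 : 0 < r / 2 := half_pos hr
  refine ⟨(‖G z₀‖ + 1) / (r / 2), ?_⟩
  filter_upwards [Metric.ball_mem_nhds z₀ hr2] with z hz
  refine ContinuousLinearMap.opNorm_le_bound _ (by positivity) fun u => ?_
  rcases eq_or_ne u 0 with rfl | hu
  · simp
  have hun : 0 < ‖u‖ := norm_pos_iff.2 hu
  have hR : 0 < r / 2 / ‖u‖ := div_pos hr2 hun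
  have hmem : ∀ s ∈ Metric.closedBall (0 : ℂ) (r / 2 / ‖u‖), z + s • u ∈ Metric.ball z₀ r := by
    intro s hs
    rw [mem_closedBall_zero_iff, le_div_iff₀ hun] at hs
    rw [Metric.mem_ball] at hz ⊢
    calc dist (z + s • u) z₀ ≤ dist (z + s • u) z + dist z z₀ := dist_triangle _ _ _
      _ < r / 2 + r / 2 := by
        refine add_lt_add_of_le_of_lt ?_ hz
        rw [dist_eq_norm, add_sub_cancel_left, norm_smul]
        exact hs
      _ = r := add_halves r
  have hd : ∀ s ∈ Metric.closedBall (0 : ℂ) (r / 2 / ‖u‖),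
      HasDerivAt (fun s : ℂ => G (z + s • u)) (fderiv ℂ G (z + s • u) u) s := by
    intro s hs
    have h1 : HasDerivAt (fun s : ℂ => z + s • u) u s := by
      simpa using ((hasDerivAt_id s).smul_const u).const_add z
    exact (hball _ (hmem s hs)).1.hasFDerivAt.comp_hasDerivAt s h1
  have hdc : DiffContOnCl ℂ (fun s : ℂ => G (z + s • u)) (Metric.ball 0 (r / 2 / ‖u‖)) := by
    refine DifferentiableOn.diffContOnCl_ball (U := Metric.closedBall 0 (r / 2 / ‖u‖))
      (fun s hs => (hd s hs).differentiableAt.differentiableWithinAt) subset_rfl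
  have hest := Complex.norm_deriv_le_of_forall_mem_sphere_norm_le hR hdc
    (fun s hs => (hball _ (hmem s (Metric.sphere_subset_closedBall hs))).2.le)
  rw [(hd 0 (Metric.mem_closedBall_self hR.le)).deriv, zero_smul, add_zero] at hest
  refine hest.trans_eq ?_
  field_simp

/-- A holomorphic solution of `‖g'‖ ≤ C ‖g‖` with a zero vanishes near that zero. -/
theorem eventually_eq_zero_of_norm_deriv_le {g : ℂ → ℂ} {t₀ : ℂ} {C : ℝ}
    (h : ∀ᶠ t in 𝓝 t₀, DifferentiableAt ℂ g t ∧ ‖deriv g t‖ ≤ C * ‖g t‖) (h0 : g t₀ = 0) :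
    ∀ᶠ t in 𝓝 t₀, g t = 0 := by
  obtain ⟨r, hr, hball⟩ := Metric.eventually_nhds_iff_ball.1 h
  filter_upwards [Metric.ball_mem_nhds t₀ hr] with t ht
  have hmem : ∀ s ∈ Set.Icc (0 : ℝ) 1, t₀ + s * (t - t₀) ∈ Metric.ball t₀ r := by
    intro s hs
    rw [mem_ball_iff_norm, add_sub_cancel_left, norm_mul, Complex.norm_real, Real.norm_of_nonneg hs.1]
    exact (mul_le_of_le_one_left (norm_nonneg _) hs.2).trans_lt (mem_ball_iff_norm.1 ht)
  have hd : ∀ s ∈ Set.Icc (0 : ℝ) 1, HasDerivAt (fun s : ℝ => g (t₀ + s * (t - t₀)))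
      (deriv g (t₀ + s * (t - t₀)) * (t - t₀)) s := by
    intro s hs
    have h1 : HasDerivAt (fun s : ℂ => t₀ + s * (t - t₀)) (t - t₀) (s : ℂ) := by
      simpa using ((hasDerivAt_id (s : ℂ)).mul_const (t - t₀)).const_add t₀
    exact ((hball _ (hmem s hs)).1.hasDerivAt.comp (s : ℂ) h1).comp_ofReal
  -- Grönwall on the real segment from `t₀` to `t`, whose parametrization contributes the factor `‖t
  -- - t₀‖`.
  have := eq_zero_of_abs_deriv_le_mul_abs_self_of_eq_zero_right (K := C * ‖t - t₀‖)
    (fun s hs => (hd s hs).continuousAt.continuousWithinAt)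
    (fun s hs => (hd s (Set.Ico_subset_Icc_self hs)).hasDerivWithinAt)
    (by simpa using h0)
    (fun s hs => by
      rw [norm_mul, mul_right_comm]
      exact mul_le_mul_of_nonneg_right (hball _ (hmem s (Set.Ico_subset_Icc_self hs))).2
        (norm_nonneg _)) 1 (Set.right_mem_Icc.2 zero_le_one)
  simpa using this

namespace TwistedOneForm

variable {n : ℕ} {μ : ℂˣ} {ω : TwistedOneForm n μ} {m : ℤ}

/-- A holomorphic curve tangent to `ω` that meets `{i_R ω = 0}` at a regular point stays in it. -/
theorem IsIntegrable.eventually_radial_eq_zero (hi : ω.IsIntegrable) (hω : ω.IsHomogeneous m)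
    {δ : ℂ → Cn n} {t₀ : ℂ}
    (hδ : ∀ᶠ t in 𝓝 t₀, DifferentiableAt ℂ δ t ∧ δ t ≠ 0 ∧ ω.form (δ t) (deriv δ t) = 0)
    (hreg : ω.form (δ t₀) ≠ 0) (h0 : ω.radial (δ t₀) = 0) :
    ∀ᶠ t in 𝓝 t₀, ω.radial (δ t) = 0 := by
  obtain ⟨hδd, hδ0, -⟩ := hδ.self_of_nhds
  -- Regularity supplies a fixed vector `v` with `ω(v)` bounded away from `0` along the curve;
  -- dividing by it will isolate the derivative of `i_R ω`.
  obtain ⟨v, hv⟩ : ∃ v, ω.form (δ t₀) v ≠ 0 := by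
    by_contra! h
    exact hreg (ContinuousLinearMap.ext h)
  have hε : 0 < ‖ω.form (δ t₀) v‖ / 2 := half_pos (norm_pos_iff.2 hv)
  set ε := ‖ω.form (δ t₀) v‖ / 2 with hεdef
  have e1 : ∀ᶠ t in 𝓝 t₀, ε < ‖ω.form (δ t) v‖ := by
    have hc : ContinuousAt (fun t => ω.form (δ t) v) t₀ :=
      (ContinuousAt.comp (f := δ) (ω.differentiableAt hδ0).continuousAt
        hδd.continuousAt).clm_apply continuousAt_const
    exact hc.norm.eventually_const_lt (half_lt_self (norm_pos_iff.2 hv))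
  have e2 : ∀ᶠ t in 𝓝 t₀, ‖deriv δ t‖ < ‖deriv δ t₀‖ + 1 := by
    have ha : AnalyticAt ℂ δ t₀ :=
      Complex.analyticAt_iff_eventually_differentiableAt.2 (hδ.mono fun t ht => ht.1)
    exact ha.deriv.continuousAt.norm.eventually_lt_const (lt_add_one _)
  obtain ⟨K, hK⟩ := exists_norm_fderiv_le (G := ω.form) (z₀ := δ t₀) (by
    filter_upwards [isOpen_compl_singleton.mem_nhds hδ0] with z hz using ω.differentiableAt hz)
  have e3 := hδd.continuousAt.eventually hK
  refine eventually_eq_zero_of_norm_deriv_le (g := fun t => ω.radial (δ t))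
    (C := 2 * K * (‖deriv δ t₀‖ + 1) * ‖v‖ / ε) ?_ h0
  filter_upwards [hδ, e1, e2, e3] with t ⟨hd, hne, htan⟩ h1 h2 h3
  have hder : HasDerivAt (fun t => ω.radial (δ t)) (fderiv ℂ ω.radial (δ t) (deriv δ t)) t :=
    (ω.hasFDerivAt_radial hne).differentiableAt.hasFDerivAt.comp_hasDerivAt t hd.hasDerivAt
  refine ⟨hder.differentiableAt, ?_⟩
  -- With `g = i_R ω` and `ω(δ') = 0`, this reads `g dω(δ', v) = dg(δ') ω(v)`.
  have key := hi.radial_mul_extDer hω hne (deriv δ t) v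
  rw [htan, mul_zero, sub_zero] at key
  have hK0 : 0 ≤ K := (norm_nonneg _).trans h3
  have hext : ‖ω.extDer (δ t) (deriv δ t) v‖ ≤ 2 * K * (‖deriv δ t₀‖ + 1) * ‖v‖ := by
    have b1 : ‖fderiv ℂ ω.form (δ t) (deriv δ t) v‖ ≤ K * ‖deriv δ t‖ * ‖v‖ :=
      (ContinuousLinearMap.le_opNorm₂ _ _ _).trans (by gcongr)
    have b2 : ‖fderiv ℂ ω.form (δ t) v (deriv δ t)‖ ≤ K * ‖v‖ * ‖deriv δ t‖ :=
      (ContinuousLinearMap.le_opNorm₂ _ _ _).trans (by gcongr)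
    calc ‖ω.extDer (δ t) (deriv δ t) v‖ ≤ K * ‖deriv δ t‖ * ‖v‖ + K * ‖v‖ * ‖deriv δ t‖ :=
          (norm_sub_le _ _).trans (add_le_add b1 b2)
      _ = 2 * K * ‖deriv δ t‖ * ‖v‖ := by ring
      _ ≤ 2 * K * (‖deriv δ t₀‖ + 1) * ‖v‖ := by gcongr
  rw [hder.deriv, div_mul_eq_mul_div, le_div_iff₀ hε]
  calc ‖fderiv ℂ ω.radial (δ t) (deriv δ t)‖ * ε
      ≤ ‖fderiv ℂ ω.radial (δ t) (deriv δ t)‖ * ‖ω.form (δ t) v‖ := by gcongr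
    _ = ‖ω.radial (δ t)‖ * ‖ω.extDer (δ t) (deriv δ t) v‖ := by
        rw [← norm_mul, ← key, norm_mul]
    _ ≤ ‖ω.radial (δ t)‖ * (2 * K * (‖deriv δ t₀‖ + 1) * ‖v‖) := by gcongr
    _ = 2 * K * (‖deriv δ t₀‖ + 1) * ‖v‖ * ‖ω.radial (δ t)‖ := mul_comm _ _

theorem IsHomogeneous.isAnalyticHypersurface [Fact (‖(μ : ℂ)‖ < 1)] (hω : ω.IsHomogeneous m)
    (hn : 2 ≤ n) (hm : 0 ≤ m) {p : Cn n} (hp : p ≠ 0) (hrad : ω.radial p ≠ 0) :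
    IsAnalyticHypersurface (E := Cn n) ω.radialZeroSet := by
  constructor
  · obtain ⟨z, hz, h⟩ := hω.exists_radial_eq_zero hn hm
    exact ⟨proj n μ ⟨z, hz⟩, ⟨z, hz⟩, rfl, h⟩
  · intro x
    refine ⟨(chartAt (Cn n) x).source, (chartAt (Cn n) x).open_source, mem_chart_source _ x,
      fun y => ω.radial (chartAt (Cn n) x y), ?_, ?_, fun y hy => hω.mem_radialZeroSet_iff hy⟩
    · intro y hy
      have h1 : DifferentiableAt ℂ ω.radial (chartAt (Cn n) x y) :=
        (ω.hasFDerivAt_radial (chartAt_ne_zero x y)).differentiableAt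
      exact (h1.mdifferentiableAt.comp y
        (mdifferentiableAt_chartAt hy)).mdifferentiableWithinAt
    · intro y hy h
      refine hrad (hω.radial_eq_zero_of_eventually (chartAt_ne_zero x y) ?_ hp)
      have ht := (chartAt (Cn n) x).map_source hy
      have hc := ((chartAt (Cn n) x).continuousAt_symm ht).tendsto
      rw [(chartAt (Cn n) x).left_inv hy] at hc
      filter_upwards [hc.eventually h, (chartAt (Cn n) x).open_target.mem_nhds ht] with z hz hz'
      rwa [(chartAt (Cn n) x).right_inv hz'] at hz

end TwistedOneForm

variable {n : ℕ} {μ : ℂˣ} [Fact (‖(μ : ℂ)‖ < 1)]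

/-- The parameters sent into the zero set form a relatively open subset of `D` by the differential
inequality, and so do the others by continuity; connectedness of `D` concludes. -/
theorem CodimOneFoliation.isInvariant_radialZeroSet (F : CodimOneFoliation n μ) {m : ℤ}
    (hF : F.IsHomogeneous m) : F.IsInvariant F.radialZeroSet := by
  intro D γ hDo hD hγ hsing htan t₀ ht₀ h₀
  have hat : ∀ t ∈ D, MDifferentiableAt 𝓘(ℂ, ℂ) 𝓘(ℂ, Cn n) γ t := fun t ht =>
    hγ.mdifferentiableAt (hDo.mem_nhds ht)
  have hsrc : ∀ t ∈ D, ∀ᶠ s in 𝓝 t, γ s ∈ (chartAt (Cn n) (γ t)).source := fun t ht =>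
    (hat t ht).continuousAt.eventually_mem (chart_source_mem_nhds (Cn n) (γ t))
  have hin : ∀ t ∈ D, γ t ∈ F.radialZeroSet → ∀ᶠ s in 𝓝 t, γ s ∈ F.radialZeroSet := by
    intro t ht h
    have hself := mem_chart_source (Cn n) (γ t)
    have := F.integrable.eventually_radial_eq_zero hF
      (δ := fun s => chartAt (Cn n) (γ t) (γ s)) (t₀ := t) ?_ ?_
      ((hF.mem_radialZeroSet_iff hself).1 h)
    · filter_upwards [this, hsrc t ht] with s hs hs' using (hF.mem_radialZeroSet_iff hs').2 hs
    · filter_upwards [hsrc t ht, hDo.mem_nhds ht] with s hs hsD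
      have hm : HasMFDerivAt 𝓘(ℂ, ℂ) 𝓘(ℂ, Cn n) (fun s => chartAt (Cn n) (γ t) (γ s)) s
          ((mfderiv 𝓘(ℂ, Cn n) 𝓘(ℂ, Cn n) (chartAt (Cn n) (γ t)) (γ s)).comp
            (mfderiv 𝓘(ℂ, ℂ) 𝓘(ℂ, Cn n) γ s)) :=
        (mdifferentiableAt_chartAt hs).hasMFDerivAt.comp s (hat s hsD).hasMFDerivAt
      have hf : HasFDerivAt (𝕜 := ℂ) (E := ℂ) (F := Cn n) _ _ s := hm.hasFDerivAt
      have hd := hf.hasDerivAt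
      refine ⟨hd.differentiableAt, chartAt_ne_zero _ _, ?_⟩
      rw [hd.deriv]
      exact (htan s hsD).form_chartAt hs
    · intro h0
      exact hsing t ht ⟨lift (γ t) (γ t), proj_lift hself, h0⟩
  have hout : ∀ t ∈ D, γ t ∉ F.radialZeroSet → ∀ᶠ s in 𝓝 t, γ s ∉ F.radialZeroSet := by
    intro t ht h
    rw [hF.mem_radialZeroSet_iff (mem_chart_source (Cn n) (γ t))] at h
    have hc : ContinuousAt (fun s => F.radial (chartAt (Cn n) (γ t) (γ s))) t :=
      ContinuousAt.comp (f := fun s => chartAt (Cn n) (γ t) (γ s))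
        (F.hasFDerivAt_radial (chartAt_ne_zero _ _)).continuousAt
        (ContinuousAt.comp (f := γ) ((chartAt (Cn n) (γ t)).continuousAt
          (mem_chart_source (Cn n) (γ t))) (hat t ht).continuousAt)
    filter_upwards [hc.eventually_ne h, hsrc t ht] with s hs hs'
    rwa [hF.mem_radialZeroSet_iff hs']
  have hcover : D ⊆ interior {t | γ t ∈ F.radialZeroSet} ∪ interior {t | γ t ∉ F.radialZeroSet} := by
    intro t ht
    by_cases h : γ t ∈ F.radialZeroSet
    · exact Or.inl (mem_interior_iff_mem_nhds.2 (hin t ht h))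
    · exact Or.inr (mem_interior_iff_mem_nhds.2 (hout t ht h))
  have hdisj : D ∩ (interior {t | γ t ∈ F.radialZeroSet} ∩
      interior {t | γ t ∉ F.radialZeroSet}) = ∅ := by
    rw [Set.eq_empty_iff_forall_notMem]
    rintro t ⟨-, h1, h2⟩
    exact (interior_subset h2 : t ∈ {t | γ t ∉ F.radialZeroSet})
      (interior_subset h1 : t ∈ {t | γ t ∈ F.radialZeroSet})
  rcases isPreconnected_iff_subset_of_disjoint.1 hD _ _ isOpen_interior isOpen_interior hcover
    hdisj with h | h
  · exact fun t ht => (interior_subset (h ht) : t ∈ {t | γ t ∈ F.radialZeroSet})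
  · exact absurd h₀ (interior_subset (h ht₀) : t₀ ∈ {t | γ t ∉ F.radialZeroSet})

theorem CodimOneFoliation.exists_form_ne_zero (F : CodimOneFoliation n μ) (hn : n ≠ 0) :
    ∃ z : Cn n, z ≠ 0 ∧ F.form z ≠ 0 := by
  have hne : (fun _ => 1 : Cn n) ≠ 0 := fun h0 => by
    simpa using congrFun h0 ⟨0, Nat.pos_of_ne_zero hn⟩
  -- The codimension condition is tested on the zero function, whose zero set is all of `X`.
  obtain ⟨x, -, -, hx⟩ := F.codim_sing Set.univ isOpen_univ (fun _ => 0)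
    mdifferentiableOn_const ⟨proj n μ ⟨_, hne⟩, trivial, rfl⟩
  obtain ⟨w, rfl⟩ := proj_surjective n μ x
  exact ⟨w, W_ne_zero w, fun h => hx ⟨w, rfl, h⟩⟩

/-! ### The period lattice `ℤ 2πi + ℤ log μ` -/

section Lattice

/-- The logarithms of the powers of `μ`. -/
noncomputable def logLattice (μ : ℂˣ) : Submodule ℤ ℂ :=
  Submodule.span ℤ {2 * (Real.pi : ℂ) * Complex.I, Complex.log μ}

theorem mem_logLattice_iff {μ : ℂˣ} {t : ℂ} :
    t ∈ logLattice μ ↔ ∃ k : ℤ, Complex.exp t = ((μ ^ k : ℂˣ) : ℂ) := by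
  have hexp : ∀ k : ℤ, Complex.exp (k * Complex.log μ) = ((μ ^ k : ℂˣ) : ℂ) := fun k => by
    rw [Complex.exp_int_mul, Complex.exp_log μ.ne_zero, Units.val_zpow_eq_zpow_val]
  rw [logLattice, Submodule.mem_span_pair]
  constructor
  · rintro ⟨a, k, rfl⟩
    refine ⟨k, ?_⟩
    rw [zsmul_eq_mul, zsmul_eq_mul, Complex.exp_add, Complex.exp_int_mul_two_pi_mul_I, one_mul,
      hexp]
  · rintro ⟨k, hk⟩
    rw [← hexp, Complex.exp_eq_exp_iff_exists_int] at hk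
    obtain ⟨a, rfl⟩ := hk
    exact ⟨a, k, by rw [zsmul_eq_mul, zsmul_eq_mul, add_comm]⟩

/-- The vector `2πi` is purely imaginary, while `Re log μ = log ‖μ‖ < 0`. -/
theorem linearIndependent_logLattice {μ : ℂˣ} (hμ : ‖(μ : ℂ)‖ < 1) :
    LinearIndependent ℝ ![2 * (Real.pi : ℂ) * Complex.I, Complex.log μ] := by
  rw [LinearIndependent.pair_iff]
  intro s t h
  have hre := congrArg Complex.re h
  have him := congrArg Complex.im h
  have hlog : Real.log ‖(μ : ℂ)‖ ≠ 0 := (Real.log_neg (norm_pos_iff.2 μ.ne_zero) hμ).ne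
  simp [Complex.log_re, hlog] at hre
  subst hre
  simp [Real.pi_ne_zero] at him
  exact ⟨him, rfl⟩

theorem exists_basis_logLattice {μ : ℂˣ} (hμ : ‖(μ : ℂ)‖ < 1) :
    ∃ b : Module.Basis (Fin 2) ℝ ℂ, logLattice μ = Submodule.span ℤ (Set.range b) := by
  refine ⟨basisOfLinearIndependentOfCardEqFinrank (linearIndependent_logLattice hμ)
    (by simp [Complex.finrank_real_complex]), ?_⟩
  rw [coe_basisOfLinearIndependentOfCardEqFinrank, logLattice, Matrix.range_cons,
    Matrix.range_cons, Matrix.range_empty, Set.union_empty, Set.singleton_union]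

theorem isZLattice_logLattice {μ : ℂˣ} (hμ : ‖(μ : ℂ)‖ < 1) :
    ∃ _ : DiscreteTopology (logLattice μ), IsZLattice ℝ (logLattice μ) := by
  obtain ⟨b, hb⟩ := exists_basis_logLattice hμ
  rw [hb]
  exact ⟨inferInstance, inferInstance⟩

end Lattice

/-! ### The radial foliation and its elliptic leaves -/

section RadialFoliation

variable {n : ℕ} {μ : ℂˣ}

/-- The flow `exp(t) w` of the radial vector field. -/
noncomputable def expSMul (w : W n) (t : ℂ) : W n := Units.mk0 _ (Complex.exp_ne_zero t) • w

theorem coe_expSMul (w : W n) (t : ℂ) : (expSMul w t : Cn n) = Complex.exp t • (w : Cn n) := rfl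

theorem hasMFDerivAt_expSMul (w : W n) (t : ℂ) :
    HasMFDerivAt 𝓘(ℂ, ℂ) 𝓘(ℂ, Cn n) (expSMul w) t
      (ContinuousLinearMap.toSpanSingleton ℂ (expSMul w t : Cn n)) := by
  have hd : HasDerivAt (fun t => Complex.exp t • (w : Cn n)) (Complex.exp t • (w : Cn n)) t :=
    (Complex.hasDerivAt_exp t).smul_const _
  refine ⟨?_, ?_⟩
  · exact (continuous_induced_rng.2
      (show Continuous fun t => Complex.exp t • (w : Cn n) by fun_prop)).continuousAt
  · simp only [mfld_simps]
    exact hd.hasFDerivAt.hasFDerivWithinAt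

theorem range_proj_expSMul (w : W n) :
    Set.range (fun t => proj n μ (expSMul w t)) =
      toProj n μ ⁻¹' {toProj n μ (proj n μ w)} := by
  ext x
  obtain ⟨w', rfl⟩ := proj_surjective n μ x
  change _ ↔ Projectivization.mk ℂ (w' : Cn n) (W_ne_zero w') =
    Projectivization.mk ℂ (w : Cn n) (W_ne_zero w)
  rw [Projectivization.mk_eq_mk_iff]
  constructor
  · rintro ⟨t, ht⟩
    obtain ⟨k, hk⟩ := proj_eq_iff.1 ht.symm
    refine ⟨μ ^ k * Units.mk0 _ (Complex.exp_ne_zero t), ?_⟩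
    rw [hk, coe_expSMul, mul_smul]
    rfl
  · rintro ⟨a, ha⟩
    refine ⟨Complex.log a, congrArg _ (Subtype.ext ?_)⟩
    rw [coe_expSMul, Complex.exp_log a.ne_zero]
    exact ha

theorem proj_expSMul_eq_iff (w : W n) {s t : ℂ} :
    proj n μ (expSMul w s) = proj n μ (expSMul w t) ↔ s - t ∈ logLattice μ := by
  rw [proj_eq_iff, mem_logLattice_iff]
  refine exists_congr fun k => ?_
  rw [coe_expSMul, coe_expSMul, smul_smul, (smul_left_injective ℂ (W_ne_zero w)).eq_iff,
    Complex.exp_sub, div_eq_iff (Complex.exp_ne_zero t)]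

variable [Fact (‖(μ : ℂ)‖ < 1)]

/-- The vector field on `X` induced by the radial vector field. -/
noncomputable def radialField (x : HopfManifold n μ) : TangentSpace 𝓘(ℂ, Cn n) x :=
  -- The tangent space at `x` is read in the preferred chart at `x`, where the radial field at `z`
  -- is `z` itself.
  (chartAt (Cn n) x x : Cn n)

/-- Chart changes are locally homotheties by `μ ^ k`, which are linear and so preserve the radial
field. In every chart it is thus the identity map, whence its holomorphy. -/
theorem trivializationAt_radialField {x y : HopfManifold n μ}
    (hy : y ∈ (chartAt (Cn n) x).source) :
    (trivializationAt (Cn n) (TangentSpace 𝓘(ℂ, Cn n)) x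
      (⟨y, radialField y⟩ : TangentBundle 𝓘(ℂ, Cn n) (HopfManifold n μ))).2 =
      chartAt (Cn n) x y := by
  have hself := mem_chart_source (Cn n) y
  have hp := proj_lift hself
  obtain ⟨k, hk⟩ := exists_chartAt_proj_eventuallyEq (x := x) (w := lift y y) (by rwa [hp])
  have hk0 := hk.self_of_nhds
  rw [hp] at hk0
  rw [TangentBundle.trivializationAt_apply, hk0]
  simp only [mfld_simps, fderivWithin_univ]
  have hev : (chartAt (Cn n) x ∘ (chartAt (Cn n) y).symm) =ᶠ[𝓝 (chartAt (Cn n) y y)]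
      fun z => ((μ ^ k : ℂˣ) : ℂ) • z := by
    have hne : ∀ᶠ z in 𝓝 (chartAt (Cn n) y y), z ∈ (chartAt (Cn n) y).target :=
      (chartAt (Cn n) y).open_target.mem_nhds (mem_chart_target (Cn n) y)
    have hk' : ∀ᶠ z in 𝓝 (chartAt (Cn n) y y), ∀ hz : z ≠ 0,
        chartAt (Cn n) x (proj n μ ⟨z, hz⟩) = ((μ ^ k : ℂˣ) : ℂ) • z := by
      rw [nhds_subtype_eq_comap, Filter.eventually_comap] at hk
      filter_upwards [hk] with z hz hz0 using hz ⟨z, hz0⟩ rfl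
    filter_upwards [hne, hk'] with z hz hz'
    have h0 : z ≠ 0 := by
      rw [← (chartAt (Cn n) y).right_inv hz]
      exact chartAt_ne_zero _ _
    have h1 : (chartAt (Cn n) y).symm z = proj n μ ⟨z, h0⟩ := by
      rw [← proj_lift ((chartAt (Cn n) y).map_target hz)]
      exact congrArg _ (Subtype.ext ((chartAt (Cn n) y).right_inv hz))
    rw [Function.comp_apply, h1, hz' h0]
  rw [hev.fderiv_eq]
  have hd : HasFDerivAt (fun z : Cn n => ((μ ^ k : ℂˣ) : ℂ) • z)
      (((μ ^ k : ℂˣ) : ℂ) • ContinuousLinearMap.id ℂ (Cn n)) (chartAt (Cn n) y y) :=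
    (((μ ^ k : ℂˣ) : ℂ) • ContinuousLinearMap.id ℂ (Cn n)).hasFDerivAt
  rw [hd.fderiv]
  rfl

theorem mdifferentiable_radialField :
    MDifferentiable 𝓘(ℂ, Cn n) 𝓘(ℂ, Cn n).tangent
      (fun x => (⟨x, radialField x⟩ : TangentBundle 𝓘(ℂ, Cn n) (HopfManifold n μ))) := by
  intro x
  rw [mdifferentiableAt_section]
  refine (mdifferentiableAt_chartAt (mem_chart_source (Cn n) x)).congr_of_eventuallyEq ?_
  filter_upwards [chart_source_mem_nhds (Cn n) x] with y hy using trivializationAt_radialField hy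

variable (n μ) in
/-- The foliation of `X` by the orbits of the radial vector field. -/
noncomputable def radialFoliation : LineFoliation (Cn n) (HopfManifold n μ) where
  line x := Submodule.span ℂ {radialField x}
  locally_spanned _ := ⟨Set.univ, isOpen_univ, trivial, radialField,
    mdifferentiable_radialField.mdifferentiableOn, fun y _ => ⟨chartAt_ne_zero y y, rfl⟩⟩

/-- The leaf is parametrized by `t ↦ π(exp(t) w)`, whose velocity is the radial field. -/
theorem isEllipticLeaf_radialFoliation (x : HopfManifold n μ) :
    (radialFoliation n μ).IsEllipticLeaf (toProj n μ ⁻¹' {toProj n μ x}) := by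
  obtain ⟨w, rfl⟩ := proj_surjective n μ x
  obtain ⟨hdisc, hlat⟩ := isZLattice_logLattice (μ := μ) Fact.out
  have hd : ∀ t, HasMFDerivAt 𝓘(ℂ, ℂ) 𝓘(ℂ, Cn n) (fun t => proj n μ (expSMul w t)) t
      ((mfderiv 𝓘(ℂ, Cn n) 𝓘(ℂ, Cn n) (proj n μ) (expSMul w t)).comp
        (ContinuousLinearMap.toSpanSingleton ℂ (expSMul w t : Cn n))) := fun t =>
    (mdifferentiableAt_proj (expSMul w t)).hasMFDerivAt.comp t (hasMFDerivAt_expSMul w t)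
  have hv : ∀ t : ℂ, mfderiv 𝓘(ℂ, ℂ) 𝓘(ℂ, Cn n) (fun t => proj n μ (expSMul w t)) t (1 : ℂ) =
      radialField (proj n μ (expSMul w t)) := by
    intro t
    rw [(hd t).mfderiv]
    refine Eq.trans ?_ (chartAt_mfderiv_proj_self (μ := μ) (expSMul w t))
    exact congrArg (mfderiv 𝓘(ℂ, Cn n) 𝓘(ℂ, Cn n) (proj n μ) (expSMul w t))
      (one_smul ℂ (expSMul w t : Cn n))
  refine ⟨logLattice μ, hdisc, hlat, fun t => proj n μ (expSMul w t),
    fun t => (hd t).mdifferentiableAt, fun t => ?_, fun t => ?_,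
    fun s t => proj_expSMul_eq_iff w, range_proj_expSMul w⟩
  · rw [hv]
    exact chartAt_ne_zero _ _
  · rw [hv]
    exact Submodule.mem_span_singleton_self _

theorem CodimOneFoliation.isSubfoliation_radialFoliation (F : CodimOneFoliation n μ)
    (h : ∀ z : Cn n, z ≠ 0 → F.radial z = 0) : F.IsSubfoliation (radialFoliation n μ) := by
  intro x v hv
  obtain ⟨c, rfl⟩ := Submodule.mem_span_singleton.1 hv
  obtain ⟨w, rfl⟩ := proj_surjective n μ x
  refine ⟨⟨w, (c • (w : Cn n) : Cn n)⟩, ?_, ?_⟩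
  · refine congrArg (Bundle.TotalSpace.mk (proj n μ w)) ?_
    refine ((mfderiv 𝓘(ℂ, Cn n) 𝓘(ℂ, Cn n) (proj n μ) w).map_smul c (w : Cn n)).trans ?_
    exact congrArg (c • ·) (chartAt_mfderiv_proj_self (μ := μ) w)
  · have := h w (W_ne_zero w)
    rw [TwistedOneForm.radial] at this
    change F.form (w : Cn n) (c • (w : Cn n)) = 0
    rw [map_smul, this, smul_zero]

end RadialFoliation

end Hopf

theorem theorem6 (n : ℕ) (hn : 3 ≤ n) (μ : ℂˣ) [Fact (‖(μ : ℂ)‖ < 1)]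
    (F : Hopf.CodimOneFoliation n μ) :
    (Hopf.IsAnalyticHypersurface (E := Hopf.Cn n) F.radialZeroSet ∧
      F.IsInvariant F.radialZeroSet) ∨
    (∃ G : Hopf.LineFoliation (Hopf.Cn n) (Hopf.HopfManifold n μ),
      F.IsSubfoliation G ∧
      ∀ x : Hopf.HopfManifold n μ,
        G.IsEllipticLeaf (Hopf.toProj n μ ⁻¹' {Hopf.toProj n μ x})) := by
  obtain ⟨m, hm⟩ := F.exists_isHomogeneous Fact.out
  have hn2 : 2 ≤ n := by omega
  by_cases h : ∀ z : Hopf.Cn n, z ≠ 0 → F.radial z = 0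
  · exact Or.inr ⟨Hopf.radialFoliation n μ, F.isSubfoliation_radialFoliation h,
      Hopf.isEllipticLeaf_radialFoliation⟩
  · push Not at h
    obtain ⟨p, hp, hrad⟩ := h
    obtain ⟨z, hz, hFz⟩ := F.exists_form_ne_zero (by omega)
    have hm0 : 0 ≤ m := by
      by_contra! hneg
      exact hFz (hm.form_eq_zero_of_neg hn2 hneg hz)
    exact Or.inl ⟨hm.isAnalyticHypersurface hn2 hm0 hp hrad, F.isInvariant_radialZeroSet hm⟩
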